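/- Let $\mathbb K$ be a field and let $\mathcal C\subseteq\mathbb K^n$ be an $[n,k]$ MDS code, i.e. a linear code of dimension $k\ge 1$ whose minimum distance is $n-k+1$. Let $G$ be a generating $k\times n$ matrix of $\mathcal C$ (its rows form a basis of $\mathcal C$). For any matrix $H$ over $\mathbb K$ with rows indexed by a finite set $S$ and columns indexed by a set of $N$ elements, let $R_H=\mathbb K[x_s: s\in S]$, let $\ell^H_j=\sum_{s\in S}H_{sj}x_s\in R_H$ be the linear form dual to the $j$-th column, and let $I_a(H)\subseteq R_H$ be the ideal generated by the $a\times a$ minors of the diagonal matrix with diagonal entries $\ell^H_j$ (so $I_0(H)=R_H$ and $I_a(H)=0$ for $a>N$). Let $$\mathrm{Fitt}(H)=\bigoplus_{a=0}^{N} I_a(H)/I_{a+1}(H)$$ be the Fitting module of $\bigoplus_j R_H/\langle\ell^H_j\rangle$, graded by $\mathrm{Fitt}(H)_d=\bigoplus_a \bigl(I_a(H)/I_{a+1}(H)\bigr)_d$. Write $R=R_G=\mathbb K[x_1,\dots,x_k]$ and $\mathrm{Fitt}(\mathcal C)=\mathrm{Fitt}(G)$. Fix a column $i$ of $G$, with dual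 form $\ell=\ell^G_i$, and $p\in\{1,\dots,k\}$. The deletion (puncturing) $\mathcal C'$ at $\ell$ is given by the matrix $G'$ obtained from $G$ by removing column $i$, and $\mathrm{Fitt}(\mathcal C')=\mathrm{Fitt}(G')$ is a graded $R$-module. There is an invertible $k\times k$ matrix $A$ such that the $i$-th column of $AG$ is the standard basis vector $e_p$. For any such $A$, the restriction (shortening) $\mathcal C''$ at $\ell$ is given by the matrix $G''$ obtained from $AG$ by removing row $p$ and column $i$; the $\mathbb K$-algebra map $\pi:R\to R'':=R_{G''}=\mathbb K[x_q: q\ne p]$, $x_j\mapsto\sum_{q\neq p}A_{qj}x_q$, is surjective with kernel $\langle\ell\rangle$, and it makes $\mathrm{Fitt}(\mathcal C'')=\mathrm{Fitt}(G'')$ a graded $R$-module. Then there is a short exact sequence of graded $R$-modules $$0\longrightarrow \mathrm{Fitt}(\mathcal C')(-1)\xrightarrow{\ \cdot\ell\ }\mathrm{Fitt}(\mathcal C)\longrightarrow\mathrm{Fitt}(\mathcal C'')\longrightarrow 0,$$ with maps homogeneous of degree $0$, where $M(-1)_d=M_{d-1}$. The first map sends the class of $x\in I_a(G')$ in $I_a(G')/I_{a+1}(G')$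 to the class of $\ell x$ in $I_{a+1}(G)/I_{a+2}(G)$, and the second sends the class of $x\in I_a(G)$ in $I_a(G)/I_{a+1}(G)$ to the class of $\pi(x)$ in $I_a(G'')/I_{a+1}(G'')$. -/

import Mathlib

open scoped DirectSum

/-! ## Linear codes -/

open Classical in
/-- The minimum distance of a linear code: the smallest weight (number of nonzero entries) of a
nonzero codeword. -/
noncomputable def minDistance {K : Type*} [Field K] {n : ℕ} (C : Submodule K (Fin n → K)) : ℕ :=
  sInf {w : ℕ | ∃ c ∈ C, c ≠ 0 ∧ w = hammingNorm c}

/-- `G` is a generating `k × n` matrix of the code `C`: the rows of `G` form a basis of `C`. In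
particular `C` has dimension `k`. -/
def IsGeneratingMatrix {K : Type*} [Field K] {n k : ℕ}
    (C : Submodule K (Fin n → K)) (G : Matrix (Fin k) (Fin n) K) : Prop :=
  LinearIndependent K G.row ∧ Submodule.span K (Set.range G.row) = C

/-- A linear code `C` of length `n` and dimension `k` is MDS if its minimum distance is
`n - k + 1`. (The zero code, which has no minimum distance, is not MDS here.) -/
def IsMDS {K : Type*} [Field K] {n : ℕ} (C : Submodule K (Fin n → K)) : Prop :=
  minDistance C + Module.finrank K C = n + 1

/-- The generating matrix of the deletion (puncturing) at the `i`-th column: remove that column. -/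
def deletion {K : Type*} {σ ι : Type*} (G : Matrix σ ι K) (i : ι) :
    Matrix σ {j : ι // j ≠ i} K :=
  G.submatrix id Subtype.val

/-- For a generating matrix `G` whose `i`-th column is the basis vector `e_p`: the generating matrix
of the restriction (shortening) at that column, obtained by removing row `p` and column `i`. -/
def restriction {K : Type*} {σ ι : Type*} (G : Matrix σ ι K) (p : σ) (i : ι) :
    Matrix {q : σ // q ≠ p} {j : ι // j ≠ i} K :=
  G.submatrix Subtype.val Subtype.val

/-! ## Linear forms -/

/-- The linear form `∑ v_s x_s` dual to the vector `v`. -/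
noncomputable def linearForm {K : Type*} [Field K] {σ : Type*} [Fintype σ] (v : σ → K) :
    MvPolynomial σ K :=
  ∑ s, MvPolynomial.C (v s) * MvPolynomial.X s

/-- The collection of linear forms dual to the columns of `G`. -/
noncomputable def columnForms {K : Type*} [Field K] {σ ι : Type*} [Fintype σ]
    (G : Matrix σ ι K) (j : ι) : MvPolynomial σ K :=
  linearForm (fun s => G s j)

/-- Restriction of polynomial functions to the hyperplane cut out by one linear form: apply the
linear change of coordinates `A`, then set the coordinate `x_p` to zero. It sends the form dual to a
vector `v` to the form dual to `A v` with the entry `p` removed. For `A = 1` this is the quotient map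
`K[x_s : s] → K[x_s : s] / (x_p) = K[x_s : s ≠ p]`. -/
noncomputable def restrictionHom {K : Type*} [Field K] {σ : Type*} [Fintype σ] [DecidableEq σ]
    (A : Matrix σ σ K) (p : σ) : MvPolynomial σ K →ₐ[K] MvPolynomial {q : σ // q ≠ p} K :=
  MvPolynomial.aeval fun j => linearForm fun q : {q : σ // q ≠ p} => A q.1 j

/-! ## Fitting modules -/

/-- The ideal `I_j(φ)` generated by the `j × j` minors of `φ`. (Choices of rows or columns with
repetitions or in another order only contribute `0` or `±` a minor.) It is the unit ideal for `j = 0`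
and zero for `j` larger than the number of rows or of columns. -/
def minorIdeal {R : Type*} [CommRing R] {m n : Type*} (φ : Matrix m n R) (j : ℕ) : Ideal R :=
  Ideal.span {a | ∃ (r : Fin j → m) (c : Fin j → n), a = (φ.submatrix r c).det}

/-- The `R`-module `I_j(φ) / I_{j+1}(φ)`. -/
abbrev FittSummand {R : Type*} [CommRing R] {m n : Type*} (φ : Matrix m n R) (j : ℕ) :
    Type _ :=
  ↥(minorIdeal φ j) ⧸ (minorIdeal φ (j + 1)).submoduleOf (minorIdeal φ j)

/-- The Fitting module `⨁_{j=0}^{N} Fitt_{N-j}(M) / Fitt_{N-j-1}(M)` of the module `M` presented by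
the matrix `φ` with `N` rows (generators of `M`), where `Fitt_{N-j}(M) = I_j(φ)`. -/
abbrev FittModule {R : Type*} [CommRing R] {m n : Type*} [Fintype m] (φ : Matrix m n R) :
    Type _ :=
  ⨁ j : Fin (Fintype.card m + 1), FittSummand φ j

/-- The class of an element of `I_j(φ)` in the summand `I_j(φ) / I_{j+1}(φ)` of the Fitting module.
(For `j` larger than the number of rows, `I_j(φ) = 0` and there is no such summand.) -/
noncomputable def fittClass {R : Type*} [CommRing R] {m n : Type*} [Fintype m]
    (φ : Matrix m n R) (j : ℕ) : ↥(minorIdeal φ j) →ₗ[R] FittModule φ :=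
  if h : j < Fintype.card m + 1 then
    (DirectSum.lof R (Fin (Fintype.card m + 1)) (fun j => FittSummand φ j) ⟨j, h⟩) ∘ₗ
      ((minorIdeal φ (j + 1)).submoduleOf (minorIdeal φ j)).mkQ
  else 0

/-- The presentation matrix `diag(ℓ_1, …, ℓ_n)` of `R/(ℓ_1) ⊕ ⋯ ⊕ R/(ℓ_n)`, where the `ℓ_j` are the
linear forms dual to the columns of `G`. -/
noncomputable abbrev codePresentation {K : Type*} [Field K] {σ ι : Type*} [Fintype σ]
    [DecidableEq ι] (G : Matrix σ ι K) : Matrix ι ι (MvPolynomial σ K) :=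
  Matrix.diagonal (columnForms G)

/-- The Fitting module of the code with generating matrix `G`, as a module over the polynomial ring
whose variables are indexed by the rows of `G`. -/
abbrev CodeFitt {K : Type*} [Field K] {σ ι : Type*} [Fintype σ] [Fintype ι] [DecidableEq ι]
    (G : Matrix σ ι K) : Type _ :=
  FittModule (codePresentation G)

/-! ## Gradings -/

/-- The homogeneous polynomials of degree `d ∈ ℤ` (only `0` if `d < 0`). -/
noncomputable def polyGrading (K : Type*) [Field K] (σ : Type*) (d : ℤ) :
    Submodule K (MvPolynomial σ K) :=
  if 0 ≤ d then MvPolynomial.homogeneousSubmodule σ K d.toNat else ⊥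

/-- The degree `d` part of the Fitting module: every component in `I_j / I_{j+1}` is the class of a
homogeneous polynomial of degree `d` in `I_j`. -/
noncomputable def fittGrading {K : Type*} [Field K] {σ ι : Type*} [Fintype σ] [Fintype ι]
    [DecidableEq ι] (G : Matrix σ ι K) (d : ℤ) : Submodule K (CodeFitt G) where
  carrier := {u | ∀ j : Fin (Fintype.card ι + 1), ∃ x : ↥(minorIdeal (codePresentation G) j),
    (x : MvPolynomial σ K) ∈ polyGrading K σ d ∧ u j = Submodule.Quotient.mk x}
  add_mem' := by
    intro a b ha hb j
    obtain ⟨x, hx, hx'⟩ := ha j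
    obtain ⟨y, hy, hy'⟩ := hb j
    exact ⟨x + y, add_mem hx hy, by rw [DirectSum.add_apply, hx', hy', Submodule.Quotient.mk_add]⟩
  zero_mem' := fun j => ⟨0, zero_mem _, by rw [DirectSum.zero_apply, Submodule.Quotient.mk_zero]⟩
  smul_mem' := by
    intro c a ha j
    obtain ⟨x, hx, hx'⟩ := ha j
    exact ⟨c • x, Submodule.smul_mem _ c hx, by
      rw [DirectSum.smul_apply, hx', Submodule.Quotient.mk_smul]⟩

/-- The grading of the twist `M(e)` of a graded module `M`: `M(e)_d = M_{d+e}`. -/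
def twist {K M : Type*} [Field K] [AddCommGroup M] [Module K M]
    (𝒜 : ℤ → Submodule K M) (e : ℤ) : ℤ → Submodule K M :=
  fun d => 𝒜 (d + e)

/-!
A product of `a + 1` distinct column forms of `G` either avoids the form `ℓ` or is `ℓ` times a
product of `a` others. In terms of the ideals `I'_a` of the deletion, `I_{a+1} = I'_{a+1} + ℓ I'_a`,
and the ideals `I''_a` of the restriction are the images of the `I'_a` modulo `ℓ`. Everything then
follows formally, except for one fact: `ℓ z ∈ I'_{a+1}` implies `z ∈ I'_a`.

The MDS property enters only through the linear independence of any `k` columns. If there are at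
least `a + k` columns besides the chosen one, then `I'_a` and `I'_{a+1}` are powers of the
irrelevant ideal `𝔪`, and the fact holds because `ℓ ∉ 𝔪²`. Otherwise `ℓ` is even a nonzerodivisor
modulo `I'_{a+1}`. This is proved, more generally modulo fewer than `k` further forms, by induction
on the number of forms that enter the products; the base case is that fewer than `k` of the forms
generate a prime ideal that contains none of the others.
-/

section FittModule

variable {R S : Type*} [CommRing R] [CommRing S] {m n m' n' : Type*}

theorem minorIdeal_zero (φ : Matrix m n R) : minorIdeal φ 0 = ⊤ :=
  (Ideal.eq_top_iff_one _).2 <| Ideal.subset_span ⟨Fin.elim0, Fin.elim0, by simp⟩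

theorem minorIdeal_eq_bot [Fintype m] (φ : Matrix m n R) {j : ℕ} (hj : Fintype.card m < j) :
    minorIdeal φ j = ⊥ := by
  rw [minorIdeal, Ideal.span_eq_bot]
  rintro _ ⟨r, c, rfl⟩
  obtain ⟨a, b, hab, hr⟩ := Fintype.exists_ne_map_eq_of_card_lt r (by simpa using hj)
  exact Matrix.det_zero_of_row_eq hab (by ext; simp [hr])

theorem minorIdeal_map {F : Type*} [FunLike F R S] [RingHomClass F R S] (f : F)
    (φ : Matrix m n R) (j : ℕ) :
    minorIdeal (φ.map f) j = (minorIdeal φ j).map f := by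
  simp only [minorIdeal, Ideal.map_span]
  congr 1
  ext y
  constructor
  · rintro ⟨r, c, rfl⟩
    exact ⟨_, ⟨r, c, rfl⟩, RingHom.map_det (f : R →+* S) _⟩
  · rintro ⟨_, ⟨r, c, rfl⟩, rfl⟩
    exact ⟨r, c, RingHom.map_det (f : R →+* S) _⟩

theorem FittSummand.mk_eq_mk_iff {φ : Matrix m n R} {j : ℕ} {x y : minorIdeal φ j} :
    (Submodule.Quotient.mk x : FittSummand φ j) = Submodule.Quotient.mk y ↔
      (x : R) - y ∈ minorIdeal φ (j + 1) :=
  Submodule.Quotient.eq _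

theorem FittSummand.mk_eq_zero_iff {φ : Matrix m n R} {j : ℕ} {x : minorIdeal φ j} :
    (Submodule.Quotient.mk x : FittSummand φ j) = 0 ↔ (x : R) ∈ minorIdeal φ (j + 1) :=
  Submodule.Quotient.mk_eq_zero _

theorem FittSummand.eq_zero_of_card_lt [Fintype m] {φ : Matrix m n R} {j : ℕ}
    (hj : Fintype.card m < j) (s : FittSummand φ j) : s = 0 := by
  obtain ⟨x, rfl⟩ := Submodule.Quotient.mk_surjective _ s
  have hx : (x : R) = 0 := by simpa [minorIdeal_eq_bot φ hj] using x.2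
  rw [mk_eq_zero_iff, hx]
  exact zero_mem _

section Components

variable [Fintype m] [Fintype m']

/-- The inclusion of the summand `I_j(φ) / I_{j+1}(φ)` in the Fitting module. Like `fittClass`, it
is defined for all `j : ℕ`; the summand is zero for `j` larger than the number of rows. -/
noncomputable def fittIncl (φ : Matrix m n R) (j : ℕ) : FittSummand φ j →ₗ[R] FittModule φ :=
  if h : j < Fintype.card m + 1 then
    DirectSum.lof R (Fin (Fintype.card m + 1)) (fun j => FittSummand φ j) ⟨j, h⟩
  else 0

/-- The projection of the Fitting module onto its summand `I_j(φ) / I_{j+1}(φ)`, for all `j : ℕ`. -/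
noncomputable def fittComponent (φ : Matrix m n R) (j : ℕ) : FittModule φ →ₗ[R] FittSummand φ j :=
  if h : j < Fintype.card m + 1 then
    DirectSum.component R (Fin (Fintype.card m + 1)) (fun j => FittSummand φ j) ⟨j, h⟩
  else 0

theorem fittClass_apply (φ : Matrix m n R) (j : ℕ) (x : minorIdeal φ j) :
    fittClass φ j x = fittIncl φ j (Submodule.Quotient.mk x) := by
  unfold fittClass fittIncl
  split_ifs <;> rfl

theorem fittComponent_coe (φ : Matrix m n R) (t : Fin (Fintype.card m + 1)) (u : FittModule φ) :
    fittComponent φ t u = u t := by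
  rw [fittComponent, dif_pos t.2]
  rfl

theorem fittComponent_fittIncl_self (φ : Matrix m n R) (j : ℕ) (s : FittSummand φ j) :
    fittComponent φ j (fittIncl φ j s) = s := by
  by_cases hj : j < Fintype.card m + 1
  · rw [fittComponent, fittIncl, dif_pos hj, dif_pos hj]
    exact DirectSum.component.lof_self ..
  · rw [FittSummand.eq_zero_of_card_lt (by omega) s, map_zero, map_zero]

theorem fittComponent_fittIncl_of_ne (φ : Matrix m n R) {i j : ℕ} (h : i ≠ j)
    (s : FittSummand φ i) : fittComponent φ j (fittIncl φ i s) = 0 := by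
  unfold fittComponent fittIncl
  split_ifs with hj hi
  · exact DirectSum.of_eq_of_ne _ _ _ fun h' => h (congrArg Fin.val h').symm
  all_goals simp

theorem FittModule.ext_component {φ : Matrix m n R} {u v : FittModule φ}
    (h : ∀ j, fittComponent φ j u = fittComponent φ j v) : u = v :=
  DFinsupp.ext fun t => by simpa only [fittComponent_coe] using h t

theorem sum_fittIncl_fittComponent (φ : Matrix m n R) (u : FittModule φ) :
    ∑ j ∈ Finset.range (Fintype.card m + 1), fittIncl φ j (fittComponent φ j u) = u := by
  refine FittModule.ext_component fun j => ?_
  rw [map_sum, Finset.sum_eq_single j, fittComponent_fittIncl_self]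
  · exact fun i _ hij => fittComponent_fittIncl_of_ne φ hij _
  · intro hj
    rw [FittSummand.eq_zero_of_card_lt (by simpa using hj) (fittComponent φ j u)]
    simp only [map_zero]

end Components

section Map

variable {φ : Matrix m n R} {ψ : Matrix m' n' S} {τ : R →+* S}

/-- The map `I_j(φ) / I_{j+1}(φ) → I_{j+e}(ψ) / I_{j+e+1}(ψ)` induced by a semilinear map of the
ground rings that shifts the ideals of minors by `e`. -/
def fittSummandMap (T : R →ₛₗ[τ] S) (e : ℕ)
    (hT : ∀ j, ∀ x ∈ minorIdeal φ j, T x ∈ minorIdeal ψ (j + e)) (j : ℕ) :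
    FittSummand φ j →ₛₗ[τ] FittSummand ψ (j + e) :=
  Submodule.mapQ _ _ ((T.comp (minorIdeal φ j).subtype).codRestrict _ fun x => hT j x x.2)
    fun x hx => add_right_comm j 1 e ▸ hT (j + 1) x hx

theorem fittSummandMap_mk_eq_zero_iff {T : R →ₛₗ[τ] S} {e : ℕ}
    {hT : ∀ j, ∀ x ∈ minorIdeal φ j, T x ∈ minorIdeal ψ (j + e)} {j : ℕ} {x : minorIdeal φ j} :
    fittSummandMap T e hT j (Submodule.Quotient.mk x) = 0 ↔ T x ∈ minorIdeal ψ (j + e + 1) :=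
  FittSummand.mk_eq_zero_iff

variable [Fintype m] [Fintype m']

/-- The map of Fitting modules with components `fittSummandMap`. -/
noncomputable def fittMap (T : R →ₛₗ[τ] S) (e : ℕ)
    (hT : ∀ j, ∀ x ∈ minorIdeal φ j, T x ∈ minorIdeal ψ (j + e)) :
    FittModule φ →ₛₗ[τ] FittModule ψ :=
  ∑ j ∈ Finset.range (Fintype.card m + 1),
    (fittIncl ψ (j + e)).comp ((fittSummandMap T e hT j).comp (fittComponent φ j))

variable (T : R →ₛₗ[τ] S) (e : ℕ) (hT : ∀ j, ∀ x ∈ minorIdeal φ j, T x ∈ minorIdeal ψ (j + e))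

theorem fittMap_apply (u : FittModule φ) :
    fittMap T e hT u = ∑ j ∈ Finset.range (Fintype.card m + 1),
      fittIncl ψ (j + e) (fittSummandMap T e hT j (fittComponent φ j u)) := by
  simp [fittMap]

theorem fittComponent_fittMap (u : FittModule φ) (j : ℕ) :
    fittComponent ψ (j + e) (fittMap T e hT u) =
      fittSummandMap T e hT j (fittComponent φ j u) := by
  rw [fittMap_apply, map_sum, Finset.sum_eq_single j, fittComponent_fittIncl_self]
  · exact fun i _ hij => fittComponent_fittIncl_of_ne ψ (by omega) _
  · intro hj
    rw [FittSummand.eq_zero_of_card_lt (by simpa using hj) (fittComponent φ j u)]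
    simp only [map_zero]

theorem fittComponent_fittMap_of_lt (u : FittModule φ) {j : ℕ} (hj : j < e) :
    fittComponent ψ j (fittMap T e hT u) = 0 := by
  rw [fittMap_apply, map_sum]
  exact Finset.sum_eq_zero fun i _ => fittComponent_fittIncl_of_ne ψ (by omega) _

theorem fittMap_fittIncl (j : ℕ) (s : FittSummand φ j) :
    fittMap T e hT (fittIncl φ j s) = fittIncl ψ (j + e) (fittSummandMap T e hT j s) := by
  rw [fittMap_apply, Finset.sum_eq_single j, fittComponent_fittIncl_self]
  · intro i _ hij
    simp only [fittComponent_fittIncl_of_ne φ hij.symm, map_zero]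
  · intro hj
    rw [FittSummand.eq_zero_of_card_lt (by simpa using hj) s]
    simp only [map_zero]

theorem fittMap_fittClass (j : ℕ) (x : minorIdeal φ j) :
    fittMap T e hT (fittClass φ j x) = fittClass ψ (j + e) ⟨T x, hT j x x.2⟩ := by
  rw [fittClass_apply, fittClass_apply, fittMap_fittIncl]
  rfl

variable {T e hT}

theorem fittMap_injective (h : ∀ j, Function.Injective (fittSummandMap T e hT j)) :
    Function.Injective (fittMap T e hT) := fun u v huv =>
  FittModule.ext_component fun j => h j <| by
    rw [← fittComponent_fittMap, huv, fittComponent_fittMap]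

theorem fittMap_surjective {hT : ∀ j, ∀ x ∈ minorIdeal φ j, T x ∈ minorIdeal ψ (j + 0)}
    (h : ∀ j, Function.Surjective (fittSummandMap T 0 hT j)) :
    Function.Surjective (fittMap T 0 hT) := by
  intro v
  choose s hs using fun j => h j (fittComponent ψ j v)
  refine ⟨∑ j ∈ Finset.range (Fintype.card m' + 1), fittIncl φ j (s j), ?_⟩
  simp only [map_sum, fittMap_fittIncl, hs]
  exact sum_fittIncl_fittComponent ψ v

theorem fittMap_exact {Q m'' n'' : Type*} [CommRing Q] [Fintype m''] {χ : Matrix m'' n'' Q}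
    {υ : S →+* Q} {U : S →ₛₗ[υ] Q}
    {hT : ∀ j, ∀ x ∈ minorIdeal φ j, T x ∈ minorIdeal ψ (j + 1)}
    {hU : ∀ j, ∀ x ∈ minorIdeal ψ j, U x ∈ minorIdeal χ (j + 0)}
    (h_zero : Function.Injective (fittSummandMap U 0 hU 0))
    (h_succ : ∀ j, Function.Exact (fittSummandMap T 1 hT j) (fittSummandMap U 0 hU (j + 1))) :
    Function.Exact (fittMap T 1 hT) (fittMap U 0 hU) := by
  refine fun v => ⟨fun hv => ?_, ?_⟩
  · have hcomp (j : ℕ) : fittSummandMap U 0 hU j (fittComponent ψ j v) = 0 := by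
      rw [← fittComponent_fittMap, hv, map_zero]
    have h0 : fittComponent ψ 0 v = 0 := h_zero (by rw [hcomp, map_zero])
    choose s hs using fun j => (h_succ j (fittComponent ψ (j + 1) v)).1 (hcomp (j + 1))
    refine ⟨∑ j ∈ Finset.range (Fintype.card m'), fittIncl φ j (s j), ?_⟩
    rw [← sum_fittIncl_fittComponent ψ v, Finset.sum_range_succ', h0, map_zero, add_zero, map_sum]
    simp only [fittMap_fittIncl, hs]
  · rintro ⟨u, rfl⟩
    refine FittModule.ext_component fun j => ?_
    refine (fittComponent_fittMap U 0 hU _ j).trans ?_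
    rcases j with - | j
    · rw [fittComponent_fittMap_of_lt T 1 hT u Nat.one_pos, map_zero, map_zero]
    · rw [fittComponent_fittMap, (h_succ j).apply_apply_eq_zero, map_zero]

end Map

end FittModule

section ProductIdeal

variable {R ι κ : Type*} [CommRing R]

/-- The ideal generated by the products of `a` distinct members of the family `l` with indices in
`A`. -/
def productIdeal (l : ι → R) (A : Finset ι) (a : ℕ) : Ideal R :=
  Ideal.span ((fun T : Finset ι => ∏ j ∈ T, l j) '' (A.powersetCard a : Set (Finset ι)))

theorem prod_mem_productIdeal (l : ι → R) {A T : Finset ι} (hT : T ⊆ A) :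
    ∏ j ∈ T, l j ∈ productIdeal l A T.card :=
  Ideal.subset_span ⟨T, Finset.mem_powersetCard.2 ⟨hT, rfl⟩, rfl⟩

theorem productIdeal_zero (l : ι → R) (A : Finset ι) : productIdeal l A 0 = ⊤ :=
  (Ideal.eq_top_iff_one _).2 <| by simpa using prod_mem_productIdeal l A.empty_subset

theorem productIdeal_eq_bot (l : ι → R) {A : Finset ι} {a : ℕ} (ha : A.card < a) :
    productIdeal l A a = ⊥ := by
  simp [productIdeal, Finset.powersetCard_eq_empty.2 ha]

theorem productIdeal_succ_le_mul (l : ι → R) (A : Finset ι) (a : ℕ) :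
    productIdeal l A (a + 1) ≤ productIdeal l A a * Ideal.span (l '' A) := by
  classical
  refine Ideal.span_le.2 ?_
  rintro _ ⟨T, hT, rfl⟩
  obtain ⟨hTA, hTa⟩ := Finset.mem_powersetCard.1 hT
  obtain ⟨j, hj⟩ := Finset.card_pos.1 (by omega : 0 < T.card)
  have hprod := prod_mem_productIdeal l ((T.erase_subset j).trans hTA)
  rw [Finset.card_erase_of_mem hj, hTa, Nat.add_sub_cancel] at hprod
  change ∏ j ∈ T, l j ∈ _
  rw [← Finset.prod_erase_mul T l hj]
  exact Ideal.mul_mem_mul hprod (Ideal.subset_span (Set.mem_image_of_mem l (hTA hj)))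

theorem productIdeal_succ_le (l : ι → R) (A : Finset ι) (a : ℕ) :
    productIdeal l A (a + 1) ≤ productIdeal l A a :=
  (productIdeal_succ_le_mul l A a).trans Ideal.mul_le_left

theorem productIdeal_insert [DecidableEq ι] (l : ι → R) {A : Finset ι} {i : ι} (hi : i ∉ A)
    (a : ℕ) : productIdeal l (insert i A) (a + 1) =
      productIdeal l A (a + 1) ⊔ Ideal.span {l i} * productIdeal l A a := by
  rw [productIdeal, Finset.powersetCard_succ_insert hi, Finset.coe_union, Set.image_union,
    Ideal.span_union, productIdeal, productIdeal, Ideal.span_mul_span', Finset.coe_image,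
    Set.singleton_mul, Set.image_image, Set.image_image]
  congr 2
  refine Set.image_congr fun T hT => Finset.prod_insert fun hiT => hi ?_
  exact (Finset.mem_powersetCard.1 hT).1 hiT

theorem productIdeal_map (l : ι → R) (e : κ ↪ ι) (A : Finset κ) (a : ℕ) :
    productIdeal l (A.map e) a = productIdeal (l ∘ e) A a := by
  simp [productIdeal, Finset.powersetCard_map, Set.image_image]

section Minors

variable [DecidableEq ι] (l : ι → R)

theorem det_submatrix_diagonal {a : ℕ} (r c : Fin a → ι) :
    ((Matrix.diagonal l).submatrix r c).det =
      (∏ b, l (r b)) * ((1 : Matrix ι ι R).submatrix r c).det := by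
  rw [← Matrix.det_diagonal, ← Matrix.det_mul]
  congr 1
  ext b b'
  simp [Matrix.diagonal_apply, Matrix.one_apply]

theorem minorIdeal_diagonal [Fintype ι] (a : ℕ) :
    minorIdeal (Matrix.diagonal l) a = productIdeal l Finset.univ a := by
  refine le_antisymm (Ideal.span_le.2 ?_) (Ideal.span_le.2 ?_)
  · rintro _ ⟨r, c, rfl⟩
    by_cases hr : Function.Injective r
    · have hprod := prod_mem_productIdeal l (Finset.subset_univ (Finset.univ.map ⟨r, hr⟩))
      rw [Finset.prod_map, Finset.card_map, Finset.card_fin] at hprod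
      rw [det_submatrix_diagonal]
      exact Ideal.mul_mem_right _ _ hprod
    · obtain ⟨b, b', hb, hne⟩ := Function.not_injective_iff.1 hr
      rw [Matrix.det_zero_of_row_eq hne (by ext; simp [hb])]
      exact zero_mem _
  · rintro _ ⟨T, hT, rfl⟩
    obtain rfl := (Finset.mem_powersetCard.1 hT).2
    let r : Fin T.card → ι := Subtype.val ∘ T.equivFin.symm
    refine Ideal.subset_span ⟨r, r, ?_⟩
    rw [Matrix.submatrix_diagonal l r (Subtype.val_injective.comp T.equivFin.symm.injective),
      Matrix.det_diagonal]
    exact (Finset.prod_coe_sort T l).symm.trans (T.equivFin.symm.prod_comp fun j => l j).symm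

theorem minorIdeal_diagonal_antitone [Finite ι] : Antitone (minorIdeal (Matrix.diagonal l)) := by
  have := Fintype.ofFinite ι
  refine antitone_nat_of_succ_le fun a => ?_
  rw [minorIdeal_diagonal, minorIdeal_diagonal]
  exact productIdeal_succ_le l _ a

end Minors

theorem productIdeal_succ_eq_mul {l : ι → R} {𝔪 : Ideal R} {k : ℕ} {A : Finset ι}
    (hl : ∀ T ⊆ A, k ≤ T.card → Ideal.span (l '' T) = 𝔪) {a : ℕ} (ha : a + k ≤ A.card) :
    productIdeal l A (a + 1) = productIdeal l A a * 𝔪 := by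
  classical
  refine le_antisymm (hl A subset_rfl (by omega) ▸ productIdeal_succ_le_mul l A a) ?_
  refine Ideal.mul_le.2 fun x hx y hy => ?_
  induction hx using Submodule.span_induction with
  | mem x hx =>
    obtain ⟨T, hT, rfl⟩ := hx
    obtain ⟨hTA, rfl⟩ := Finset.mem_powersetCard.1 hT
    -- The members of the family outside `T` are still numerous enough to generate `𝔪`.
    rw [← hl (A \ T) Finset.sdiff_subset (by rw [Finset.card_sdiff_of_subset hTA]; omega)] at hy
    induction hy using Submodule.span_induction with
    | mem y hy =>
      obtain ⟨j, hj, rfl⟩ := hy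
      obtain ⟨hjA, hjT⟩ := Finset.mem_sdiff.1 hj
      have hprod := prod_mem_productIdeal l (Finset.insert_subset hjA hTA)
      rwa [Finset.card_insert_of_notMem hjT, Finset.prod_insert hjT, mul_comm] at hprod
    | zero => simp
    | add y z _ _ hy hz => simpa only [mul_add] using add_mem hy hz
    | smul c y _ hy => simpa only [mul_smul_comm] using Submodule.smul_mem _ c hy
  | zero => simp
  | add x z _ _ hx hz => simpa only [add_mul] using add_mem hx hz
  | smul c x _ hx => simpa only [smul_mul_assoc] using Submodule.smul_mem _ c hx

theorem productIdeal_eq_pow {l : ι → R} {𝔪 : Ideal R} {k : ℕ} {A : Finset ι}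
    (hl : ∀ T ⊆ A, k ≤ T.card → Ideal.span (l '' T) = 𝔪) {a : ℕ} (ha : a + k ≤ A.card + 1) :
    productIdeal l A a = 𝔪 ^ a := by
  induction a with
  | zero => rw [productIdeal_zero, pow_zero, Ideal.one_eq_top]
  | succ a ih => rw [productIdeal_succ_eq_mul hl (by omega), ih (by omega), pow_succ]

theorem isSMulRegular_quotient_sup_span_singleton_mul {I I' : Ideal R} (hI : I' ≤ I) {x h : R}
    (hx' : IsSMulRegular (R ⧸ (Ideal.span {h} ⊔ I')) x) (hx : IsSMulRegular (R ⧸ I) x)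
    (hh : IsSMulRegular (R ⧸ I) h) : IsSMulRegular (R ⧸ (I' ⊔ Ideal.span {h} * I)) x := by
  rw [isSMulRegular_quotient_iff_mem_of_smul_mem] at hx' hx hh ⊢
  simp only [smul_eq_mul] at hx' hx hh ⊢
  intro z hz
  have hle : I' ⊔ Ideal.span {h} * I ≤ Ideal.span {h} ⊔ I' :=
    sup_le le_sup_right (Ideal.mul_le_left.trans le_sup_left)
  obtain ⟨w, y, hy, rfl⟩ := Ideal.mem_span_singleton_sup.1 (hx' z (hle hz))
  have hxwh : x * w * h ∈ I := by
    have hxz : x * (w * h + y) ∈ I := sup_le hI Ideal.mul_le_right hz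
    rw [mul_add, ← mul_assoc] at hxz
    exact (I.add_mem_iff_left (I.mul_mem_left x (hI hy))).1 hxz
  have hw : w ∈ I := hx w (hh _ (mul_comm h _ ▸ hxwh))
  rw [add_comm, mul_comm w]
  exact Submodule.add_mem_sup hy (Ideal.mul_mem_mul (Ideal.mem_span_singleton_self h) hw)

theorem isSMulRegular_quotient_span_sup_productIdeal {l : ι → R} {k : ℕ}
    (hl : ∀ (Q : Finset ι), ∀ i ∉ Q, Q.card < k → IsSMulRegular (R ⧸ Ideal.span (l '' Q)) (l i))
    {A Q : Finset ι} (hAQ : Disjoint A Q) {i : ι} (hiA : i ∉ A) (hiQ : i ∉ Q) (hQ : Q.card < k)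
    {a : ℕ} (hA : A.card + Q.card + 1 < k + a) :
    IsSMulRegular (R ⧸ (Ideal.span (l '' Q) ⊔ productIdeal l A a)) (l i) := by
  classical
  induction A using Finset.induction_on generalizing Q i a with
  | empty =>
    rcases a with - | a
    · rw [productIdeal_zero, sup_top_eq]
      exact fun _ _ _ => Subsingleton.elim _ _
    · rw [productIdeal_eq_bot l (by simp), sup_bot_eq]
      exact hl Q i hiQ hQ
  | insert h A hhA ih =>
    rcases a with - | a
    · rw [productIdeal_zero, sup_top_eq]
      exact fun _ _ _ => Subsingleton.elim _ _
    rw [Finset.card_insert_of_notMem hhA] at hA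
    obtain haA | haA := lt_or_ge A.card a
    · rw [productIdeal_eq_bot l (by rw [Finset.card_insert_of_notMem hhA]; omega), sup_bot_eq]
      exact hl Q i hiQ hQ
    obtain ⟨hhQ, hAQ⟩ := Finset.disjoint_insert_left.1 hAQ
    obtain ⟨hih, hiA⟩ := not_or.1 (mt Finset.mem_insert.2 hiA)
    set J := Ideal.span (l '' Q)
    have hspan : Ideal.span (l '' (insert h Q : Finset ι)) = Ideal.span {l h} ⊔ J := by
      rw [Finset.coe_insert, Set.image_insert_eq, Ideal.span_insert]
    have hsplit : J ⊔ productIdeal l (insert h A) (a + 1) =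
        J ⊔ productIdeal l A (a + 1) ⊔ Ideal.span {l h} * (J ⊔ productIdeal l A a) := by
      have hmul : Ideal.span {l h} * J ≤ J := Ideal.mul_le_right
      rw [productIdeal_insert l hhA, Ideal.mul_sup, ← sup_assoc, ← sup_assoc,
        sup_right_comm J _ (Ideal.span {l h} * J), sup_eq_left.2 hmul]
    have hinsert := ih (Finset.disjoint_insert_right.2 ⟨hhA, hAQ⟩) hiA
      (by simp [hih, hiQ]) (a := a + 1)
      (by rw [Finset.card_insert_of_notMem hhQ]; omega)
      (by rw [Finset.card_insert_of_notMem hhQ]; omega)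
    rw [hspan, sup_assoc] at hinsert
    rw [hsplit]
    exact isSMulRegular_quotient_sup_span_singleton_mul
      (sup_le_sup_left (productIdeal_succ_le l A a) J) hinsert
      (ih hAQ hiA hiQ hQ (by omega)) (ih hAQ hhA hhQ hQ (by omega))

end ProductIdeal

section LinearForm

open MvPolynomial

variable {K : Type*} [Field K] {σ τ : Type*} [Fintype σ] [Fintype τ]

/-- `linearForm` as a linear map. -/
noncomputable def linearFormMap (K σ : Type*) [Field K] [Fintype σ] :
    (σ → K) →ₗ[K] MvPolynomial σ K where
  toFun := linearForm
  map_add' v w := by simp only [linearForm, Pi.add_apply, C_add, add_mul, Finset.sum_add_distrib]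
  map_smul' c v := by
    simp only [linearForm, Pi.smul_apply, smul_eq_mul, C_mul, mul_assoc, smul_eq_C_mul,
      Finset.mul_sum, RingHom.id_apply]

theorem linearForm_single [DecidableEq σ] (s : σ) : linearForm (Pi.single s (1 : K)) = X s := by
  rw [linearForm, Finset.sum_eq_single s] <;> simp +contextual

theorem linearForm_isHomogeneous (v : σ → K) : (linearForm v).IsHomogeneous 1 :=
  IsHomogeneous.sum _ _ _ fun s _ => isHomogeneous_C_mul_X (v s) s

theorem coeff_linearForm (v : σ → K) (s : σ) : coeff (Finsupp.single s 1) (linearForm v) = v s := by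
  classical
  simp [linearForm, coeff_sum, coeff_C_mul, coeff_X, Finsupp.single_left_inj]

theorem linearForm_eq_zero_iff {v : σ → K} : linearForm v = 0 ↔ v = 0 := by
  refine ⟨fun h => funext fun s => ?_, fun h => h ▸ map_zero (linearFormMap K σ)⟩
  rw [← coeff_linearForm v, h, coeff_zero, Pi.zero_apply]

theorem span_linearForm_image_span (s : Set (σ → K)) :
    Ideal.span (linearForm '' (Submodule.span K s : Set (σ → K))) =
      Ideal.span (linearForm '' s) := by
  refine le_antisymm (Ideal.span_le.2 ?_) (Ideal.span_mono (Set.image_mono Submodule.subset_span))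
  rw [Set.image_subset_iff]
  change Submodule.span K s ≤
    ((Ideal.span (linearForm '' s)).restrictScalars K).comap (linearFormMap K σ)
  exact Submodule.span_le.2 fun v hv => Ideal.subset_span (Set.mem_image_of_mem _ hv)

theorem span_linearForm_image_eq_idealOfVars {s : Set (σ → K)} (hs : Submodule.span K s = ⊤) :
    Ideal.span (linearForm '' s) = idealOfVars σ K := by
  classical
  rw [← span_linearForm_image_span, hs, ← (Pi.basisFun K σ).span_eq, span_linearForm_image_span,
    ← Set.range_comp, idealOfVars]
  congr 2
  ext1 s
  rw [Function.comp_apply, Pi.basisFun_apply, linearForm_single]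

section Substitution

variable [DecidableEq σ]

/-- The `K`-algebra map that sends the form dual to `v` to the form dual to `L v`. -/
noncomputable def linearSubst (L : (σ → K) →ₗ[K] (τ → K)) :
    MvPolynomial σ K →ₐ[K] MvPolynomial τ K :=
  aeval fun s => linearForm (L (Pi.single s 1))

variable {L : (σ → K) →ₗ[K] (τ → K)}

theorem linearSubst_linearForm (L : (σ → K) →ₗ[K] (τ → K)) (v : σ → K) :
    linearSubst L (linearForm v) = linearForm (L v) := by
  suffices h : (linearSubst L).toLinearMap ∘ₗ linearFormMap K σ = linearFormMap K τ ∘ₗ L from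
    LinearMap.congr_fun h v
  refine (Pi.basisFun K σ).ext fun s => ?_
  rw [Pi.basisFun_apply]
  change linearSubst L (linearForm (Pi.single s 1)) = linearForm (L (Pi.single s 1))
  rw [linearForm_single, linearSubst, aeval_X]

omit [Fintype σ] in
theorem linearSubst_surjective [Finite σ] (hL : Function.Surjective L) :
    Function.Surjective (linearSubst L) := by
  classical
  have := Fintype.ofFinite σ
  rw [← AlgHom.range_eq_top, eq_top_iff, ← adjoin_range_X, Algebra.adjoin_le_iff]
  rintro _ ⟨t, rfl⟩
  obtain ⟨v, hv⟩ := hL (Pi.single t 1)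
  exact ⟨linearForm v, (linearSubst_linearForm L v).trans (by rw [hv, linearForm_single])⟩

theorem ker_linearSubst (L : (σ → K) →ₗ[K] (τ → K)) :
    RingHom.ker (linearSubst L) = Ideal.span (linearForm '' (LinearMap.ker L : Set (σ → K))) := by
  classical
  refine le_antisymm (fun z hz => ?_) (Ideal.span_le.2 ?_)
  · set I := Ideal.span (linearForm '' (LinearMap.ker L : Set (σ → K)))
    -- A generalized inverse of `L` induces an inverse of `linearSubst L` modulo `I`.
    obtain ⟨M, hM⟩ : ∃ M : (τ → K) →ₗ[K] (σ → K), ∀ v, L (M (L v)) = L v := by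
      obtain ⟨N, hN⟩ := L.rangeRestrict.exists_rightInverse_of_surjective L.range_rangeRestrict
      obtain ⟨M, rfl⟩ := N.exists_extend
      exact ⟨M, fun v => congrArg Subtype.val (LinearMap.congr_fun hN (L.rangeRestrict v))⟩
    have hcomp : (Ideal.Quotient.mkₐ K I).comp ((linearSubst M).comp (linearSubst L)) =
        Ideal.Quotient.mkₐ K I := by
      refine algHom_ext fun s => (Ideal.Quotient.mk_eq_mk_iff_sub_mem _ _).2 ?_
      change linearSubst M (linearSubst L (X s)) - X s ∈ I
      rw [← linearForm_single, linearSubst_linearForm, linearSubst_linearForm]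
      refine Ideal.subset_span ⟨M (L (Pi.single s 1)) - Pi.single s 1, ?_, ?_⟩
      · rw [SetLike.mem_coe, LinearMap.mem_ker, map_sub, hM, sub_self]
      · exact map_sub (linearFormMap K σ) _ _
    have hmk := DFunLike.congr_fun hcomp z
    rw [AlgHom.comp_apply, AlgHom.comp_apply, RingHom.mem_ker.1 hz, map_zero, map_zero] at hmk
    exact Ideal.Quotient.eq_zero_iff_mem.1 hmk.symm
  · rintro _ ⟨v, hv, rfl⟩
    rw [SetLike.mem_coe, RingHom.mem_ker, linearSubst_linearForm, LinearMap.mem_ker.1 hv,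
      linearForm_eq_zero_iff]

end Substitution

theorem isSMulRegular_quotient_span_linearForm {s : Set (σ → K)} {w : σ → K}
    (hw : w ∉ Submodule.span K s) :
    IsSMulRegular (MvPolynomial σ K ⧸ Ideal.span (linearForm '' s)) (linearForm w) := by
  classical
  obtain ⟨W, hW⟩ := (Submodule.span K s).exists_isCompl
  have hker := W.ker_projection hW.symm
  rw [← span_linearForm_image_span, ← hker, ← ker_linearSubst,
    isSMulRegular_quotient_iff_mem_of_smul_mem]
  intro z hz
  rw [RingHom.mem_ker, smul_eq_mul, map_mul, linearSubst_linearForm] at hz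
  refine (mul_eq_zero.1 hz).resolve_left fun h => hw ?_
  rwa [linearForm_eq_zero_iff, ← LinearMap.mem_ker, hker] at h

theorem mem_pow_idealOfVars_iff_le_order {R ι : Type*} [CommRing R] {p : MvPolynomial ι R} {a : ℕ} :
    p ∈ idealOfVars ι R ^ a ↔ a ≤ (p : MvPowerSeries ι R).order := by
  rw [mem_pow_idealOfVars_iff']
  refine ⟨fun h => MvPowerSeries.nat_le_order fun d hd => ?_, fun h d hd => ?_⟩
  · rw [coeff_coe, h d hd]
  · rw [← coeff_coe, MvPowerSeries.coeff_of_lt_order ((Nat.cast_lt.2 hd).trans_le h)]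

theorem mem_pow_idealOfVars_of_mul_mem {R ι : Type*} [CommRing R] [NoZeroDivisors R]
    {f z : MvPolynomial ι R} {a b : ℕ} (hf : f ∉ idealOfVars ι R ^ (b + 1))
    (hz : f * z ∈ idealOfVars ι R ^ (a + b)) : z ∈ idealOfVars ι R ^ a := by
  rw [mem_pow_idealOfVars_iff_le_order] at hf hz ⊢
  have hfb : (f : MvPowerSeries ι R).order ≤ b := Order.le_of_lt_add_one (by simpa using hf)
  rw [coe_mul, MvPowerSeries.order_mul, Nat.cast_add, add_comm] at hz
  exact (ENat.add_le_add_iff_left (ENat.natCast_ne_top b)).1 (hz.trans (add_le_add_left hfb _))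

theorem linearForm_notMem_idealOfVars_sq {v : σ → K} (hv : v ≠ 0) :
    linearForm v ∉ idealOfVars σ K ^ 2 := by
  rw [mem_pow_idealOfVars_iff']
  refine fun h => hv (funext fun s => ?_)
  rw [← coeff_linearForm v, h _ (by simp), Pi.zero_apply]

end LinearForm

section Restriction

open MvPolynomial

variable {K : Type*} [Field K] {σ ι : Type*} [Fintype σ] [DecidableEq σ] {A : Matrix σ σ K} {p : σ}

theorem restrictionHom_eq_linearSubst (A : Matrix σ σ K) (p : σ) :
    restrictionHom A p =
      linearSubst (LinearMap.funLeft K K ((↑) : {q : σ // q ≠ p} → σ) ∘ₗ A.mulVecLin) := by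
  refine algHom_ext fun s => ?_
  rw [restrictionHom, linearSubst, aeval_X, aeval_X, LinearMap.comp_apply, Matrix.mulVecLin_apply,
    Matrix.mulVec_single_one]
  rfl

theorem restrictionHom_linearForm (A : Matrix σ σ K) (p : σ) (v : σ → K) :
    restrictionHom A p (linearForm v) = linearForm fun q => A.mulVec v q.1 := by
  rw [restrictionHom_eq_linearSubst, linearSubst_linearForm]
  rfl

theorem restrictionHom_surjective (hA : IsUnit A) : Function.Surjective (restrictionHom A p) := by
  rw [restrictionHom_eq_linearSubst]
  exact linearSubst_surjective <|
    (LinearMap.funLeft_surjective_of_injective K K _ Subtype.val_injective).comp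
      (Matrix.mulVec_surjective_iff_isUnit.2 hA)

theorem ker_restrictionHom (hA : IsUnit A) {v : σ → K} (hv : A.mulVec v = Pi.single p 1) :
    RingHom.ker (restrictionHom A p) = Ideal.span {linearForm v} := by
  have hker : LinearMap.ker (LinearMap.funLeft K K ((↑) : {q : σ // q ≠ p} → σ) ∘ₗ A.mulVecLin) =
      Submodule.span K {v} := by
    ext w
    rw [Submodule.mem_span_singleton, LinearMap.mem_ker]
    constructor
    · intro hw
      refine ⟨A.mulVec w p, Matrix.mulVec_injective_of_isUnit hA (funext fun q => ?_)⟩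
      rw [Matrix.mulVec_smul, hv]
      by_cases hq : q = p
      · simp [hq]
      · simpa [hq] using (congrFun hw ⟨q, hq⟩).symm
    · rintro ⟨c, rfl⟩
      ext q
      simp [hv, q.2]
  rw [restrictionHom_eq_linearSubst, ker_linearSubst, hker, span_linearForm_image_span,
    Set.image_singleton]

theorem exists_isUnit_mulVec_eq {v w : σ → K} (hv : v ≠ 0) (hw : w ≠ 0) :
    ∃ A : Matrix σ σ K, IsUnit A ∧ A.mulVec v = w := by
  obtain ⟨g, hg⟩ := Submodule.exists_linearEquiv_restrict_eq
    ((LinearEquiv.toSpanNonzeroSingleton K _ v hv).symm ≪≫ₗ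
      LinearEquiv.toSpanNonzeroSingleton K _ w hw)
  refine ⟨LinearMap.toMatrix' g.toLinearMap, LinearMap.isUnit_toMatrix'_iff.2
    ((Module.End.isUnit_iff _).2 g.bijective), ?_⟩
  have hgv := hg (LinearEquiv.toSpanNonzeroSingleton K _ v hv 1)
  rw [LinearEquiv.trans_apply, LinearEquiv.symm_apply_apply] at hgv
  simpa using hgv.symm

variable [DecidableEq ι] {G : Matrix σ ι K} {i : ι}

theorem minorIdeal_restriction (A : Matrix σ σ K) (p : σ) (a : ℕ) :
    minorIdeal (codePresentation (restriction (A * G) p i)) a =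
      (minorIdeal (codePresentation (deletion G i)) a).map (restrictionHom A p) := by
  rw [← minorIdeal_map, Matrix.diagonal_map (map_zero _)]
  congr 2
  exact congrArg Matrix.diagonal <| funext fun j => (restrictionHom_linearForm A p (G.col j.1)).symm

theorem restrictionHom_mem_minorIdeal_iff (hA : IsUnit A)
    (hi : (fun q => (A * G) q i) = Pi.single p 1) {a : ℕ} {x : MvPolynomial σ K} :
    restrictionHom A p x ∈ minorIdeal (codePresentation (restriction (A * G) p i)) a ↔
      ∃ y ∈ minorIdeal (codePresentation (deletion G i)) a, ∃ z, y + columnForms G i * z = x := by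
  have hker : RingHom.ker (restrictionHom A p) = Ideal.span {columnForms G i} :=
    ker_restrictionHom hA hi
  rw [← Ideal.mem_comap, minorIdeal_restriction,
    Ideal.comap_map_of_surjective' _ (restrictionHom_surjective hA), hker, Submodule.mem_sup]
  simp only [Ideal.mem_span_singleton', mul_comm _ (columnForms G i), exists_exists_eq_and]

end Restriction

section GeneralPosition

variable {K : Type*} [Field K] {σ ι : Type*} [Fintype σ]

/-- A family of vectors of `K^σ` is in general position if any `card σ` or fewer of its members are
linearly independent. -/
def InGeneralPosition (v : ι → σ → K) : Prop :=
  ∀ T : Finset ι, T.card ≤ Fintype.card σ → LinearIndepOn K v (T : Set ι)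

namespace InGeneralPosition

variable {v : ι → σ → K} (hv : InGeneralPosition v)

include hv

theorem span_image_eq_top {T : Finset ι} (hT : Fintype.card σ ≤ T.card) :
    Submodule.span K (v '' T) = ⊤ := by
  obtain ⟨B, hBT, hB⟩ := Finset.exists_subset_card_eq hT
  have htop : Submodule.span K (Set.range fun j : B => v j) = ⊤ :=
    (hv B hB.le).span_eq_top_of_card_eq_finrank' (by simp [hB])
  rw [eq_top_iff, ← htop]
  refine Submodule.span_mono ?_
  rintro _ ⟨j, rfl⟩
  exact Set.mem_image_of_mem v (hBT j.2)

theorem notMem_span_image {Q : Finset ι} {i : ι} (hi : i ∉ Q) (hQ : Q.card < Fintype.card σ) :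
    v i ∉ Submodule.span K (v '' Q) := by
  classical
  have hiQ := hv (insert i Q) (by rw [Finset.card_insert_of_notMem hi]; omega)
  rw [Finset.coe_insert] at hiQ
  exact hiQ.notMem_span_of_insert hi

variable [Nonempty σ]

theorem ne_zero (i : ι) : v i ≠ 0 := by
  simpa using hv.notMem_span_image (Finset.notMem_empty i) Fintype.card_pos

theorem mem_productIdeal_of_mul_mem {A : Finset ι} {i : ι} (hi : i ∉ A) {a : ℕ}
    {z : MvPolynomial σ K}
    (hz : linearForm (v i) * z ∈ productIdeal (linearForm ∘ v) A (a + 1)) :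
    z ∈ productIdeal (linearForm ∘ v) A a := by
  obtain ha | ha := le_or_gt (a + Fintype.card σ) A.card
  · have hpow (T : Finset ι) (_ : T ⊆ A) (hT : Fintype.card σ ≤ T.card) :
        Ideal.span (linearForm ∘ v '' T) = MvPolynomial.idealOfVars σ K := by
      rw [Set.image_comp, span_linearForm_image_eq_idealOfVars (hv.span_image_eq_top hT)]
    rw [productIdeal_eq_pow hpow (by omega)] at hz ⊢
    exact mem_pow_idealOfVars_of_mul_mem (linearForm_notMem_idealOfVars_sq (hv.ne_zero i)) hz
  · have hreg (Q : Finset ι) (j : ι) (hj : j ∉ Q) (hQ : Q.card < Fintype.card σ) :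
        IsSMulRegular (MvPolynomial σ K ⧸ Ideal.span (linearForm ∘ v '' Q))
          ((linearForm ∘ v) j) := by
      rw [Set.image_comp]
      exact isSMulRegular_quotient_span_linearForm (hv.notMem_span_image hj hQ)
    have hregA := isSMulRegular_quotient_span_sup_productIdeal hreg A.disjoint_empty_right hi
      (Finset.notMem_empty i) Fintype.card_pos (a := a + 1) (by rw [Finset.card_empty]; omega)
    rw [Finset.coe_empty, Set.image_empty, Ideal.span_empty, bot_sup_eq] at hregA
    exact productIdeal_succ_le _ A a (mem_of_isSMulRegular_quotient_of_smul_mem hregA hz)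

end InGeneralPosition

end GeneralPosition

section MDS

variable {K : Type*} [Field K] {n k : ℕ} {C : Submodule K (Fin n → K)}
  {G : Matrix (Fin k) (Fin n) K}

theorem IsGeneratingMatrix.finrank_eq (hG : IsGeneratingMatrix C G) : Module.finrank K C = k := by
  rw [← hG.2, finrank_span_eq_card hG.1, Fintype.card_fin]

theorem IsGeneratingMatrix.vecMul_mem (hG : IsGeneratingMatrix C G) (w : Fin k → K) :
    Matrix.vecMul w G ∈ C := by
  rw [← hG.2, ← range_vecMulLinear]
  exact ⟨w, rfl⟩

theorem IsMDS.eq_zero_of_vecMul_eq_zero (hC : IsMDS C) (hG : IsGeneratingMatrix C G)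
    {T : Finset (Fin n)} (hT : k ≤ T.card) {w : Fin k → K}
    (hw : ∀ j ∈ T, Matrix.vecMul w G j = 0) : w = 0 := by
  classical
  by_contra hw0
  have hwG : Matrix.vecMul w G ≠ 0 := fun h =>
    hw0 (Matrix.vecMul_injective_iff.2 hG.1 (h.trans (Matrix.zero_vecMul G).symm))
  have hmin : minDistance C ≤ hammingNorm (Matrix.vecMul w G) :=
    Nat.sInf_le ⟨_, hG.vecMul_mem w, hwG, rfl⟩
  have hnorm : hammingNorm (Matrix.vecMul w G) ≤ Tᶜ.card :=
    Finset.card_le_card fun j hj =>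
      Finset.mem_compl.2 fun hjT => (Finset.mem_filter.1 hj).2 (hw j hjT)
  have hTn := T.card_le_univ
  rw [Finset.card_compl] at hnorm
  rw [Fintype.card_fin] at hTn hnorm
  rw [IsMDS, hG.finrank_eq] at hC
  omega

theorem IsMDS.inGeneralPosition_col (hC : IsMDS C) (hG : IsGeneratingMatrix C G) :
    InGeneralPosition G.col := by
  intro T hT
  have hkn : k ≤ n := by simpa using hG.1.fintype_card_le_finrank
  obtain ⟨B, hTB, hB⟩ := Finset.exists_superset_card_eq (by simpa using hT) (by simpa using hkn)
  refine LinearIndepOn.mono ?_ (Finset.coe_subset.2 hTB)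
  let e := B.equivFinOfCardEq hB
  have hunit : IsUnit (G.submatrix id (Subtype.val ∘ e.symm)) := by
    refine Matrix.vecMul_injective_iff_isUnit.1 <|
      (injective_iff_map_eq_zero (Matrix.vecMulLinear _)).2 fun w hw => ?_
    refine hC.eq_zero_of_vecMul_eq_zero hG hB.ge fun j hj => ?_
    have hwj := congrFun hw (e ⟨j, hj⟩)
    simpa [Matrix.vecMul, dotProduct] using hwj
  exact (linearIndependent_equiv e.symm).1 (Matrix.linearIndependent_cols_iff_isUnit.2 hunit)

end MDS

section Grading

variable {K : Type*} [Field K] {σ σ' ι κ : Type*} [Fintype σ] [Fintype σ']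

theorem linearForm_mul_mem_polyGrading (v : σ → K) {d : ℤ} {x : MvPolynomial σ K}
    (hx : x ∈ polyGrading K σ (d - 1)) : linearForm v * x ∈ polyGrading K σ d := by
  unfold polyGrading at *
  split_ifs at hx with hd
  · rw [if_pos (by omega), MvPolynomial.mem_homogeneousSubmodule]
    convert (linearForm_isHomogeneous v).mul hx using 1
    omega
  · rw [(Submodule.mem_bot K).1 hx, mul_zero]
    exact zero_mem _

theorem restrictionHom_mem_polyGrading [DecidableEq σ] (A : Matrix σ σ K) (p : σ) {d : ℤ}
    {x : MvPolynomial σ K} (hx : x ∈ polyGrading K σ d) :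
    restrictionHom A p x ∈ polyGrading K {q : σ // q ≠ p} d := by
  unfold polyGrading at *
  split_ifs at * with hd
  · rw [MvPolynomial.mem_homogeneousSubmodule, ← one_mul d.toNat]
    exact MvPolynomial.IsHomogeneous.aeval hx _ fun j => linearForm_isHomogeneous _
  · rw [(Submodule.mem_bot K).1 hx, map_zero]
    exact zero_mem _

variable [Fintype ι] [DecidableEq ι] [Fintype κ] [DecidableEq κ]

theorem mem_fittGrading_iff {G : Matrix σ ι K} {d : ℤ} {u : CodeFitt G} :
    u ∈ fittGrading G d ↔ ∀ j, ∃ x : minorIdeal (codePresentation G) j,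
      (x : MvPolynomial σ K) ∈ polyGrading K σ d ∧
        fittComponent (codePresentation G) j u = Submodule.Quotient.mk x := by
  refine ⟨fun hu j => ?_, fun hu j => by simpa only [fittComponent_coe] using hu j⟩
  by_cases hj : j < Fintype.card ι + 1
  · obtain ⟨x, hx, hux⟩ := hu ⟨j, hj⟩
    exact ⟨x, hx, (fittComponent_coe _ ⟨j, hj⟩ u).trans hux⟩
  · exact ⟨0, zero_mem _, FittSummand.eq_zero_of_card_lt (by omega) _⟩

theorem fittMap_mem_fittGrading {G : Matrix σ ι K} {H : Matrix σ' κ K}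
    {τ : MvPolynomial σ K →+* MvPolynomial σ' K} {T : MvPolynomial σ K →ₛₗ[τ] MvPolynomial σ' K}
    {e : ℕ} {hT : ∀ j, ∀ x ∈ minorIdeal (codePresentation G) j,
      T x ∈ minorIdeal (codePresentation H) (j + e)} {c d : ℤ}
    (hTd : ∀ x ∈ polyGrading K σ c, T x ∈ polyGrading K σ' d) {u : CodeFitt G}
    (hu : u ∈ fittGrading G c) : fittMap T e hT u ∈ fittGrading H d := by
  rw [mem_fittGrading_iff] at hu ⊢
  intro j
  obtain hj | ⟨j, rfl⟩ := (lt_or_ge j e).imp_right Nat.exists_eq_add_of_le'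
  · exact ⟨0, zero_mem _, fittComponent_fittMap_of_lt T e hT u hj⟩
  · obtain ⟨x, hx, hux⟩ := hu j
    exact ⟨⟨T x, hT j x x.2⟩, hTd x hx, by rw [fittComponent_fittMap, hux]; rfl⟩

end Grading

section DeletionRestriction

variable {K : Type*} [Field K] {σ ι : Type*} [Fintype σ] [DecidableEq ι]

section MinorIdeal

variable (G : Matrix σ ι K) (i : ι)

theorem minorIdeal_deletion [Fintype ι] (a : ℕ) :
    minorIdeal (codePresentation (deletion G i)) a =
    productIdeal (columnForms G) (Finset.univ.erase i) a := by
  have huniv : (Finset.univ : Finset {j : ι // j ≠ i}).map (.subtype _) = Finset.univ.erase i := by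
    ext j
    simp
  rw [minorIdeal_diagonal, ← huniv, productIdeal_map]
  rfl

variable [Finite ι]

theorem minorIdeal_codePresentation_succ (a : ℕ) : minorIdeal (codePresentation G) (a + 1) =
    minorIdeal (codePresentation (deletion G i)) (a + 1) ⊔
      Ideal.span {columnForms G i} * minorIdeal (codePresentation (deletion G i)) a := by
  have := Fintype.ofFinite ι
  rw [minorIdeal_deletion, minorIdeal_deletion, minorIdeal_diagonal,
    ← Finset.insert_erase (Finset.mem_univ i), productIdeal_insert _ (Finset.notMem_erase _ _),
    Finset.erase_insert (Finset.notMem_erase _ _)]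

theorem minorIdeal_deletion_le (a : ℕ) :
    minorIdeal (codePresentation (deletion G i)) a ≤ minorIdeal (codePresentation G) a := by
  rcases a with - | a
  · rw [minorIdeal_zero, minorIdeal_zero]
  · exact minorIdeal_codePresentation_succ G i a ▸ le_sup_left

variable {G i}

theorem mul_mem_minorIdeal_of_mem_deletion {a : ℕ} {x : MvPolynomial σ K}
    (hx : x ∈ minorIdeal (codePresentation (deletion G i)) a) :
    columnForms G i * x ∈ minorIdeal (codePresentation G) (a + 1) := by
  rw [minorIdeal_codePresentation_succ G i]
  exact Ideal.mem_sup_right (Ideal.mul_mem_mul (Ideal.mem_span_singleton_self _) hx)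

theorem mem_minorIdeal_deletion_of_mul_mem [Nonempty σ] (hG : InGeneralPosition G.col) {a : ℕ}
    {z : MvPolynomial σ K} (hz : columnForms G i * z ∈ minorIdeal (codePresentation G) (a + 1)) :
    z ∈ minorIdeal (codePresentation (deletion G i)) a := by
  rw [minorIdeal_codePresentation_succ G i] at hz
  obtain ⟨y, hy, _, hℓw, hyw⟩ := Submodule.mem_sup.1 hz
  obtain ⟨w, hw, rfl⟩ := Ideal.mem_span_singleton_mul.1 hℓw
  have hzw : columnForms G i * (z - w) = y := by rw [mul_sub, ← hyw, add_sub_cancel_right]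
  have := Fintype.ofFinite ι
  rw [minorIdeal_deletion] at hy hw ⊢
  exact (Submodule.sub_mem_iff_left _ hw).1 <|
    hG.mem_productIdeal_of_mul_mem (Finset.notMem_erase _ _) (hzw ▸ hy)

variable [DecidableEq σ] {A : Matrix σ σ K} {p : σ}

theorem restrictionHom_mem_minorIdeal (hA : IsUnit A)
    (hi : (fun q => (A * G) q i) = Pi.single p 1) {a : ℕ} {x : MvPolynomial σ K}
    (hx : x ∈ minorIdeal (codePresentation G) a) :
    restrictionHom A p x ∈ minorIdeal (codePresentation (restriction (A * G) p i)) a := by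
  rcases a with - | a
  · rw [minorIdeal_zero]
    exact Submodule.mem_top
  · rw [minorIdeal_codePresentation_succ G i] at hx
    obtain ⟨y, hy, _, hw, rfl⟩ := Submodule.mem_sup.1 hx
    obtain ⟨w, -, rfl⟩ := Ideal.mem_span_singleton_mul.1 hw
    exact (restrictionHom_mem_minorIdeal_iff hA hi).2 ⟨y, hy, w, rfl⟩

theorem mem_minorIdeal_one_of_restrictionHom_mem (hA : IsUnit A)
    (hi : (fun q => (A * G) q i) = Pi.single p 1) {x : MvPolynomial σ K}
    (hx : restrictionHom A p x ∈ minorIdeal (codePresentation (restriction (A * G) p i)) 1) :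
    x ∈ minorIdeal (codePresentation G) 1 := by
  obtain ⟨y, hy, z, rfl⟩ := (restrictionHom_mem_minorIdeal_iff hA hi).1 hx
  have hz : z ∈ minorIdeal (codePresentation (deletion G i)) 0 :=
    minorIdeal_zero (codePresentation (deletion G i)) ▸ Submodule.mem_top
  exact add_mem (minorIdeal_deletion_le G i 1 hy) (mul_mem_minorIdeal_of_mem_deletion hz)

theorem exists_sub_mul_mem_minorIdeal [Nonempty σ] (hG : InGeneralPosition G.col) (hA : IsUnit A)
    (hi : (fun q => (A * G) q i) = Pi.single p 1) {a : ℕ} {x : MvPolynomial σ K}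
    (hx : x ∈ minorIdeal (codePresentation G) (a + 1))
    (hπx : restrictionHom A p x ∈
      minorIdeal (codePresentation (restriction (A * G) p i)) (a + 2)) :
    ∃ z ∈ minorIdeal (codePresentation (deletion G i)) a,
      x - columnForms G i * z ∈ minorIdeal (codePresentation G) (a + 2) := by
  obtain ⟨y, hy, z, rfl⟩ := (restrictionHom_mem_minorIdeal_iff hA hi).1 hπx
  refine ⟨z, mem_minorIdeal_deletion_of_mul_mem hG ?_, ?_⟩
  · have hy' := minorIdeal_diagonal_antitone _ (Nat.le_succ (a + 1)) hy
    exact (Submodule.add_mem_iff_right _ (minorIdeal_deletion_le G i _ hy')).1 hx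
  · rw [add_sub_cancel_right]
    exact minorIdeal_deletion_le G i _ hy

end MinorIdeal

section Maps

variable [Fintype ι] {G : Matrix σ ι K} {i : ι}

/-- The map `Fitt(C')(-1) → Fitt(C)` given by multiplication by the form dual to the `i`-th column,
where `C'` is the deletion at that column. -/
noncomputable def deletionMap (G : Matrix σ ι K) (i : ι) :
    CodeFitt (deletion G i) →ₗ[MvPolynomial σ K] CodeFitt G :=
  fittMap (LinearMap.mulLeft _ (columnForms G i)) 1 fun _ _ => mul_mem_minorIdeal_of_mem_deletion

theorem deletionMap_injective [Nonempty σ] (hG : InGeneralPosition G.col) :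
    Function.Injective (deletionMap G i) := by
  refine fittMap_injective fun j => (injective_iff_map_eq_zero _).2 fun s hs => ?_
  obtain ⟨x, rfl⟩ := Submodule.Quotient.mk_surjective _ s
  exact FittSummand.mk_eq_zero_iff.2 <|
    mem_minorIdeal_deletion_of_mul_mem hG (fittSummandMap_mk_eq_zero_iff.1 hs)

variable [DecidableEq σ] {A : Matrix σ σ K} {p : σ}

/-- The map `Fitt(C) → Fitt(C'')` induced by `restrictionHom`, where `C''` is the restriction at the
`i`-th column. -/
noncomputable def restrictionMap (hA : IsUnit A) (hi : (fun q => (A * G) q i) = Pi.single p 1) :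
    CodeFitt G →ₛₗ[(restrictionHom A p : MvPolynomial σ K →+* MvPolynomial {q : σ // q ≠ p} K)]
      CodeFitt (restriction (A * G) p i) :=
  fittMap
    (restrictionHom A p : MvPolynomial σ K →+* MvPolynomial {q // q ≠ p} K).toSemilinearMap 0
    fun _ _ hx => restrictionHom_mem_minorIdeal hA hi hx

theorem restrictionMap_surjective (hA : IsUnit A) (hi : (fun q => (A * G) q i) = Pi.single p 1) :
    Function.Surjective (restrictionMap hA hi) := by
  refine fittMap_surjective fun j s => ?_
  obtain ⟨⟨y, hy⟩, rfl⟩ := Submodule.Quotient.mk_surjective _ s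
  rw [Nat.add_zero, minorIdeal_restriction,
    Ideal.mem_map_iff_of_surjective _ (restrictionHom_surjective hA)] at hy
  obtain ⟨x, hx, rfl⟩ := hy
  exact ⟨Submodule.Quotient.mk ⟨x, minorIdeal_deletion_le G i j hx⟩, rfl⟩

theorem exact_deletionMap_restrictionMap [Nonempty σ] (hG : InGeneralPosition G.col) (hA : IsUnit A)
    (hi : (fun q => (A * G) q i) = Pi.single p 1) :
    Function.Exact (deletionMap G i) (restrictionMap hA hi) := by
  refine fittMap_exact ((injective_iff_map_eq_zero _).2 fun s hs => ?_)
    fun j s => ⟨fun hs => ?_, ?_⟩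
  · obtain ⟨x, rfl⟩ := Submodule.Quotient.mk_surjective _ s
    have hπx := fittSummandMap_mk_eq_zero_iff.1 hs
    exact FittSummand.mk_eq_zero_iff.2 (mem_minorIdeal_one_of_restrictionHom_mem hA hi hπx)
  · obtain ⟨x, rfl⟩ := Submodule.Quotient.mk_surjective _ s
    have hπx := fittSummandMap_mk_eq_zero_iff.1 hs
    obtain ⟨z, hz, hxz⟩ := exists_sub_mul_mem_minorIdeal hG hA hi x.2 hπx
    exact ⟨Submodule.Quotient.mk ⟨z, hz⟩, Eq.symm (FittSummand.mk_eq_mk_iff.2 hxz)⟩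
  · rintro ⟨s, rfl⟩
    obtain ⟨x, rfl⟩ := Submodule.Quotient.mk_surjective _ s
    exact fittSummandMap_mk_eq_zero_iff.2 <|
      (restrictionHom_mem_minorIdeal_iff hA hi).2 ⟨0, zero_mem _, x, zero_add _⟩

end Maps

end DeletionRestriction

theorem theorem2p5_general {K σ ι : Type*} [Field K] [Fintype σ] [DecidableEq σ] [Fintype ι]
    [DecidableEq ι] (G : Matrix σ ι K) (hG : InGeneralPosition G.col) (i : ι) (p : σ) :
    (∃ A : Matrix σ σ K, IsUnit A ∧ (fun q => (A * G) q i) = Pi.single p 1) ∧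
    ∀ A : Matrix σ σ K, IsUnit A → (fun q => (A * G) q i) = Pi.single p 1 →
    ∃ (f : CodeFitt (deletion G i) →ₗ[MvPolynomial σ K] CodeFitt G)
      (g : CodeFitt G →ₛₗ[(restrictionHom A p : MvPolynomial σ K →+*
          MvPolynomial {q : σ // q ≠ p} K)] CodeFitt (restriction (A * G) p i)),
      (Function.Surjective (restrictionHom A p) ∧
        RingHom.ker (restrictionHom A p) = Ideal.span {columnForms G i}) ∧
      Function.Injective f ∧ Function.Exact f g ∧ Function.Surjective g ∧
      (∀ d : ℤ, ∀ u ∈ twist (fittGrading (deletion G i)) (-1) d, f u ∈ fittGrading G d) ∧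
      (∀ d : ℤ, ∀ u ∈ fittGrading G d, g u ∈ fittGrading (restriction (A * G) p i) d) ∧
      (∀ (j : ℕ) (x : ↥(minorIdeal (codePresentation (deletion G i)) j)),
        ∃ y : ↥(minorIdeal (codePresentation G) (j + 1)),
          (y : MvPolynomial σ K) = columnForms G i * x ∧
            f (fittClass _ j x) = fittClass _ (j + 1) y) ∧
      (∀ (j : ℕ) (x : ↥(minorIdeal (codePresentation G) j)),
        ∃ y : ↥(minorIdeal (codePresentation (restriction (A * G) p i)) j),
          (y : MvPolynomial {q : σ // q ≠ p} K) = restrictionHom A p x ∧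
            g (fittClass _ j x) = fittClass _ j y) := by
  have : Nonempty σ := ⟨p⟩
  refine ⟨exists_isUnit_mulVec_eq (hG.ne_zero i) (Pi.single_ne_zero_iff.2 one_ne_zero),
    fun A hA hi => ⟨deletionMap G i, restrictionMap hA hi,
      ⟨restrictionHom_surjective hA, ker_restrictionHom hA hi⟩, deletionMap_injective hG,
      exact_deletionMap_restrictionMap hG hA hi, restrictionMap_surjective hA hi, ?_, ?_, ?_, ?_⟩⟩
  · exact fun d u => fittMap_mem_fittGrading fun x => linearForm_mul_mem_polyGrading _
  · exact fun d u => fittMap_mem_fittGrading fun x => restrictionHom_mem_polyGrading A p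
  · exact fun j x => ⟨_, rfl, fittMap_fittClass _ 1 _ j x⟩
  · exact fun j x => ⟨_, rfl, fittMap_fittClass _ 0 _ j x⟩

theorem theorem2p5 {K : Type*} [Field K] {n k : ℕ}
    (C : Submodule K (Fin n → K)) (hMDS : IsMDS C)
    (G : Matrix (Fin k) (Fin n) K) (hG : IsGeneratingMatrix C G)
    (i : Fin n)
    (p : Fin k) :
    -- there are row operations `A` that turn the `i`-th column of `G` into the basis vector `e_p`
    (∃ A : Matrix (Fin k) (Fin k) K, IsUnit A ∧ (fun q => (A * G) q i) = Pi.single p 1) ∧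
    -- and for any such `A`, with the restriction obtained from `A * G`, there is an exact sequence
    ∀ A : Matrix (Fin k) (Fin k) K, IsUnit A → (fun q => (A * G) q i) = Pi.single p 1 →
    -- the second map is semilinear along `R → R''`, that is, `R`-linear for the
    -- `R`-module structure that the Fitting module of the restriction gets from `R → R''`
    ∃ (f : CodeFitt (deletion G i) →ₗ[MvPolynomial (Fin k) K] CodeFitt G)
      (g : CodeFitt G →ₛₗ[(restrictionHom A p : MvPolynomial (Fin k) K →+*
          MvPolynomial {q : Fin k // q ≠ p} K)] CodeFitt (restriction (A * G) p i)),
      -- the ring map `R → R''` is the quotient by the form `ℓ` dual to the `i`-th column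
      (Function.Surjective (restrictionHom A p) ∧
        RingHom.ker (restrictionHom A p) = Ideal.span {columnForms G i}) ∧
      -- exactness
      Function.Injective f ∧ Function.Exact f g ∧ Function.Surjective g ∧
      -- both maps are homogeneous of degree zero
      (∀ d : ℤ, ∀ u ∈ twist (fittGrading (deletion G i)) (-1) d, f u ∈ fittGrading G d) ∧
      (∀ d : ℤ, ∀ u ∈ fittGrading G d, g u ∈ fittGrading (restriction (A * G) p i) d) ∧
      -- the first map is multiplication by `ℓ`, from `I'_j / I'_{j+1}` to `I_{j+1} / I_{j+2}`
      (∀ (j : ℕ) (x : ↥(minorIdeal (codePresentation (deletion G i)) j)),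
        ∃ y : ↥(minorIdeal (codePresentation G) (j + 1)),
          (y : MvPolynomial (Fin k) K) = columnForms G i * x ∧
            f (fittClass _ j x) = fittClass _ (j + 1) y) ∧
      -- the second map is induced by `R → R''`, from `I_j / I_{j+1}` to `I''_j / I''_{j+1}`
      (∀ (j : ℕ) (x : ↥(minorIdeal (codePresentation G) j)),
        ∃ y : ↥(minorIdeal (codePresentation (restriction (A * G) p i)) j),
          (y : MvPolynomial {q : Fin k // q ≠ p} K) = restrictionHom A p x ∧
            g (fittClass _ j x) = fittClass _ j y) :=
  theorem2p5_general G (hMDS.inGeneralPosition_col hG) i p
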